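/- Let $R$ be a Noetherian ring and let $\mathrm{Mod}\,R$ be the category of left $R$-modules. A module $G$ is Gorenstein projective if $G\cong\ker d^0$ for some exact complex $\cdots\to P^{-1}\to P^0\xrightarrow{d^0}P^1\to\cdots$ of projective modules that stays exact under $\mathrm{Hom}_R(-,Q)$ for every projective module $Q$; let $Gp(R)$ be the class of these modules. Assume that $Gp(R)$ is contravariantly finite in $\mathrm{Mod}\,R$, i.e. for every module $M$ there is a morphism $G\to M$ with $G\in Gp(R)$ through which every morphism $G'\to M$ with $G'\in Gp(R)$ factors. A sequence of modules (of the form $Y\to Z\to 0$, $X\to Y\to Z\to 0$, $0\to X\to Y\to Z\to 0$, or a resolution) is $G$-exact if it is exact and stays exact under $\mathrm{Hom}_R(G,-)$ for every $G\in Gp(R)$. A proper Gorenstein-projective resolution of $M$ is a $G$-exact sequence $\cdots\to G_1\to G_0\to M\to 0$ with all $G_i\in Gp(R)$; $\mathrm{Gext}^i_R(M,N)$ denotes the $i$-th cohomology group of $\mathrm{Hom}_R(G_\bullet,N)$. A proper Gorenstein-projective presentation of $T$ is a morphism $\theta\colon G_1\to G_0$ that is part of a $G$-exact sequence $G_1\xrightarrow{\theta}G_0\to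 T\to 0$ with $G_1,G_0\in Gp(R)$; for such $\theta$ put $D_\theta=\{X : \mathrm{Hom}_R(\theta,X)\text{ is surjective}\}$. For a module $T$ let $\mathrm{Add}\,T$ be the class of direct summands of direct sums of copies of $T$, and let \begin{align*} \mathrm{Gen}_G(T)&=\{M : \text{there is a } G\text{-exact sequence } T_0\to M\to 0 \text{ with } T_0\in \mathrm{Add}\,T\},\\ \mathrm{Pres}_G(T)&=\{M : \text{there is a } G\text{-exact sequence } T_1\to T_0\to M\to 0 \text{ with } T_0,T_1\in \mathrm{Add}\,T\},\\ T^{G\perp}&=\{M : \mathrm{Gext}^1_R(T,M)=0\}. \end{align*} The module $T$ is called Gorenstein tilting if $T^{G\perp}=\mathrm{Pres}_G(T)$; Gorenstein silting if $\mathrm{Gen}_G(T)=D_\theta$ for some proper Gorenstein-projective presentation $\theta$ of $T$; and a Gorenstein star module if $\mathrm{Gen}_G(T)=\mathrm{Pres}_G(T)$ and every $G$-exact sequence $0\to X\to T_0\to Y\to 0$ with $T_0\in\mathrm{Add}\,T$ and $X\in\mathrm{Gen}_G(T)$ stays exact under $\mathrm{Hom}_R(T,-)$. Then: (1) every Gorenstein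 tilting $R$-module is Gorenstein silting; (2) every Gorenstein silting $R$-module is a Gorenstein star module. -/

import Mathlib

universe u

namespace GorensteinSilting

/-! All modules are left modules over a ring `R`, in the universe of `R`. -/

section

variable {R : Type u} [Ring R]

/-! ### Gorenstein projective modules -/

/-- `M` is Gorenstein projective: there is an exact complex
`⋯ ⟶ P (-1) ⟶ P 0 ⟶ P 1 ⟶ ⋯` of projective modules, which remains exact under `Hom_R(-, Q)` for
every projective module `Q`, such that `M` is isomorphic to the kernel of `d 0 : P 0 ⟶ P 1`. -/
def IsGorensteinProjective (M : ModuleCat.{u} R) : Prop :=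
  ∃ (P : ℤ → ModuleCat.{u} R) (d : ∀ n : ℤ, P n →ₗ[R] P (n + 1)),
    (∀ n, Module.Projective R (P n)) ∧
    (∀ n, Function.Exact (d n) (d (n + 1))) ∧
    (∀ Q : ModuleCat.{u} R, Module.Projective R Q → ∀ n,
      Function.Exact (fun g : P (n + 1 + 1) →ₗ[R] Q => g ∘ₗ d (n + 1))
        (fun f : P (n + 1) →ₗ[R] Q => f ∘ₗ d n)) ∧
    Nonempty (M ≃ₗ[R] LinearMap.ker (d 0))

variable (R) in
/-- The class `Gp(R)` of Gorenstein projective modules is contravariantly finite in `Mod R`: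
every module has a right `Gp(R)`-approximation. -/
def GpContravariantlyFinite : Prop :=
  ∀ M : ModuleCat.{u} R, ∃ (G : ModuleCat.{u} R) (f : G →ₗ[R] M), IsGorensteinProjective G ∧
    ∀ G' : ModuleCat.{u} R, IsGorensteinProjective G' → ∀ h : G' →ₗ[R] M,
      ∃ k : G' →ₗ[R] G, f ∘ₗ k = h

/-! ### `G`-exact sequences -/

/-- The map `Hom_R(H, f) : Hom_R(H, X) → Hom_R(H, Y)`. -/
def homPost (H : ModuleCat.{u} R) {X Y : ModuleCat.{u} R} (f : X →ₗ[R] Y) :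
    (H →ₗ[R] X) → (H →ₗ[R] Y) :=
  fun h => f ∘ₗ h

/-- The sequence `Y ⟶ Z ⟶ 0` given by `g` is `G`-exact, that is, `g` is a `G`-epimorphism. -/
def IsGEpi {Y Z : ModuleCat.{u} R} (g : Y →ₗ[R] Z) : Prop :=
  Function.Surjective g ∧
    ∀ G : ModuleCat.{u} R, IsGorensteinProjective G → Function.Surjective (homPost G g)

/-- The sequence `X ⟶ Y ⟶ Z ⟶ 0` is `G`-exact: it is exact and stays exact under `Hom_R(G, -)` for
every Gorenstein projective `G`. -/
def IsGRightExact {X Y Z : ModuleCat.{u} R} (f : X →ₗ[R] Y) (g : Y →ₗ[R] Z) : Prop :=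
  (Function.Exact f g ∧ Function.Surjective g) ∧
    ∀ G : ModuleCat.{u} R, IsGorensteinProjective G →
      Function.Exact (homPost G f) (homPost G g) ∧ Function.Surjective (homPost G g)

/-- The sequence `0 ⟶ X ⟶ Y ⟶ Z ⟶ 0` stays exact under `Hom_R(H, -)`. -/
def IsHomShortExact (H : ModuleCat.{u} R) {X Y Z : ModuleCat.{u} R}
    (f : X →ₗ[R] Y) (g : Y →ₗ[R] Z) : Prop :=
  Function.Injective (homPost H f) ∧ Function.Exact (homPost H f) (homPost H g) ∧
    Function.Surjective (homPost H g)

/-- The sequence `0 ⟶ X ⟶ Y ⟶ Z ⟶ 0` is `G`-exact: it is exact and stays exact under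
`Hom_R(G, -)` for every Gorenstein projective `G`. -/
def IsGShortExact {X Y Z : ModuleCat.{u} R} (f : X →ₗ[R] Y) (g : Y →ₗ[R] Z) : Prop :=
  (Function.Injective f ∧ Function.Exact f g ∧ Function.Surjective g) ∧
    ∀ G : ModuleCat.{u} R, IsGorensteinProjective G → IsHomShortExact G f g

/-! ### Proper Gorenstein projective resolutions and `Gext` -/

/-- A proper Gorenstein projective resolution `⋯ ⟶ G 1 ⟶ G 0 ⟶ M ⟶ 0`: an exact sequence with all
`G n` Gorenstein projective, which stays exact under `Hom_R(E, -)` for every Gorenstein projective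
module `E`. -/
structure ProperGpResolution (M : ModuleCat.{u} R) where
  G : ℕ → ModuleCat.{u} R
  isGorensteinProjective : ∀ n, IsGorensteinProjective (G n)
  d : ∀ n, G (n + 1) →ₗ[R] G n
  ε : G 0 →ₗ[R] M
  augmentation : IsGRightExact (d 0) ε
  exact : ∀ n, Function.Exact (d (n + 1)) (d n)
  hom_exact : ∀ E : ModuleCat.{u} R, IsGorensteinProjective E → ∀ n,
    Function.Exact (homPost E (d (n + 1))) (homPost E (d n))

namespace ProperGpResolution

variable {M : ModuleCat.{u} R} (𝒢 : ProperGpResolution M) (N : ModuleCat.{u} R)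

/-- The differential `Hom_R(G n, N) ⟶ Hom_R(G (n + 1), N)`. -/
def coboundary (n : ℕ) : (𝒢.G n →ₗ[R] N) →+ (𝒢.G (n + 1) →ₗ[R] N) where
  toFun f := f ∘ₗ 𝒢.d n
  map_zero' := LinearMap.zero_comp _
  map_add' f g := LinearMap.add_comp (𝒢.d n) g f

/-- The `n`-coboundaries of the complex `Hom_R(G •, N)`. -/
def boundaries : ∀ n : ℕ, AddSubgroup (𝒢.G n →ₗ[R] N)
  | 0 => ⊥
  | n + 1 => (𝒢.coboundary N n).range

/-- `Gext^n_R(M, N)` computed with the proper Gorenstein projective resolution `𝒢` of `M`: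
the `n`-th cohomology group of the complex `Hom_R(G •, N)`. -/
abbrev Gext (n : ℕ) : Type u :=
  (𝒢.coboundary N n).ker ⧸ (𝒢.boundaries N n).addSubgroupOf (𝒢.coboundary N n).ker

end ProperGpResolution

/-! ### Classes of modules attached to a module or to a morphism -/

/-- `Add T`: the direct summands of direct sums of copies of `T`. -/
def Add (T : ModuleCat.{u} R) : Set (ModuleCat.{u} R) :=
  {N | ∃ (I : Type u) (i : N →ₗ[R] (I →₀ T)) (p : (I →₀ T) →ₗ[R] N), p ∘ₗ i = LinearMap.id}

/-- `Pres_G(T)`: the modules `M` with a `G`-exact sequence `T₁ ⟶ T₀ ⟶ M ⟶ 0`, `T₁, T₀ ∈ Add T`. -/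
def PresG (T : ModuleCat.{u} R) : Set (ModuleCat.{u} R) :=
  {M | ∃ T₁ ∈ Add T, ∃ T₀ ∈ Add T, ∃ (f : T₁ →ₗ[R] T₀) (g : T₀ →ₗ[R] M), IsGRightExact f g}

/-- `Gen_G(T)`: the modules `M` with a `G`-exact sequence `T₀ ⟶ M ⟶ 0`, `T₀ ∈ Add T`. -/
def GenG (T : ModuleCat.{u} R) : Set (ModuleCat.{u} R) :=
  {M | ∃ T₀ ∈ Add T, ∃ g : T₀ →ₗ[R] M, IsGEpi g}

/-- `T^{G⊥}`: the modules `M` with `Gext^1_R(T, M) = 0`. When `Gp(R)` is contravariantly finite,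
`T` has a proper Gorenstein projective resolution, and `Gext` does not depend on its choice. -/
def GPerp (T : ModuleCat.{u} R) : Set (ModuleCat.{u} R) :=
  {M | ∀ 𝒢 : ProperGpResolution T, Subsingleton (𝒢.Gext M 1)}

/-- `D_θ`: the modules `X` for which `Hom_R(θ, X) : Hom_R(G₀, X) ⟶ Hom_R(G₁, X)` is surjective. -/
def D {G₁ G₀ : ModuleCat.{u} R} (θ : G₁ →ₗ[R] G₀) : Set (ModuleCat.{u} R) :=
  {X | Function.Surjective (fun g : G₀ →ₗ[R] X => g ∘ₗ θ)}

/-! ### Gorenstein tilting, silting and star modules -/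

/-- `θ : G₁ ⟶ G₀` is (with some `π : G₀ ⟶ T`) a proper Gorenstein projective presentation
`G₁ ⟶ G₀ ⟶ T ⟶ 0` of `T`. -/
def IsProperGpPresentation (T : ModuleCat.{u} R) {G₁ G₀ : ModuleCat.{u} R}
    (θ : G₁ →ₗ[R] G₀) : Prop :=
  IsGorensteinProjective G₁ ∧ IsGorensteinProjective G₀ ∧
    ∃ π : G₀ →ₗ[R] T, IsGRightExact θ π

/-- `T` is Gorenstein tilting: `T^{G⊥} = Pres_G(T)`. -/
def IsGorensteinTilting (T : ModuleCat.{u} R) : Prop :=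
  GPerp T = PresG T

/-- `T` is Gorenstein silting: `Gen_G(T) = D_θ` for some proper Gorenstein projective
presentation `θ` of `T`. -/
def IsGorensteinSilting (T : ModuleCat.{u} R) : Prop :=
  ∃ (G₁ G₀ : ModuleCat.{u} R) (θ : G₁ →ₗ[R] G₀), IsProperGpPresentation T θ ∧ GenG T = D θ

/-- `T` is a Gorenstein star module: every `G`-exact sequence `0 ⟶ X ⟶ T₀ ⟶ Y ⟶ 0` with
`T₀ ∈ Add T` and `X ∈ Gen_G(T)` stays exact under `Hom_R(T, -)`, and `Gen_G(T) = Pres_G(T)`. -/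
def IsGorensteinStar (T : ModuleCat.{u} R) : Prop :=
  (∀ (X T₀ Y : ModuleCat.{u} R) (f : X →ₗ[R] T₀) (g : T₀ →ₗ[R] Y),
      T₀ ∈ Add T → X ∈ GenG T → IsGShortExact f g → IsHomShortExact T f g) ∧
    GenG T = PresG T

end

end GorensteinSilting

namespace GorensteinSilting

section

variable {R : Type u} [Ring R]

/-! ### Linear maps and exactness -/

section LinearMaps

variable {A B C : Type u} [AddCommGroup A] [Module R A] [AddCommGroup B] [Module R B]
  [AddCommGroup C] [Module R C]

/-! For silting implies star, correct a lift. A map G₁ → X extends along θ when X lies in D_θ =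
Gen_G(T), so a lift G₀ → T₀ of a map T → Y can be altered to vanish on im θ and descends to T. For
Gen_G(T) = Pres_G(T), the same kind of correction is applied to the universal map T^(Hom(T,M)) → M,
and shows that its kernel lies in D_θ.

For tilting implies silting, the universal map also gives T^{G⊥} = Gen_G(T), a class closed under
G-epimorphic images. Take a G-epimorphism π : G → T with G Gorenstein projective. If K = ker π is
Gorenstein projective, the inclusion K → G is a proper presentation whose D_θ is T^{G⊥}. To see that
K is Gorenstein projective, approximate it by x : X → K with W = ker x satisfying Ext¹(Gp(R), W) =
0, and embed W in an injective E. Then E → E/W is a G-epimorphism, so E/W is in T^{G⊥}; extending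
and lifting the induced map K → E/W splits W off X, so K is a summand of X.

The main difficulty is such an x, since no minimal approximation is available for Wakamatsu's lemma.
Modulo projectives, an approximation f : G₀ → M gives an idempotent on the cone of an approximation
of ker f. An Eilenberg swindle splits it inside Gp(R), and the image maps to M with the required
kernel. -/

theorem exists_factor_of_surjective (f : A →ₗ[R] B) (hf : Function.Surjective f) (g : A →ₗ[R] C)
    (h : ∀ a, f a = 0 → g a = 0) : ∃ k : B →ₗ[R] C, ∀ a, k (f a) = g a := by
  refine ⟨(LinearMap.ker f).liftQ g (fun a ha => h a ha) ∘ₗ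
    (f.quotKerEquivOfSurjective hf).symm.toLinearMap, fun a => ?_⟩
  have : (f.quotKerEquivOfSurjective hf).symm (f a) = (LinearMap.ker f).mkQ a := by
    rw [LinearEquiv.symm_apply_eq]; rfl
  rw [LinearMap.comp_apply, LinearEquiv.coe_coe, this]
  rfl

theorem exists_lift_of_injective (f : B →ₗ[R] C) (hf : Function.Injective f) (g : A →ₗ[R] C)
    (h : ∀ a, ∃ b, f b = g a) : ∃ k : A →ₗ[R] B, ∀ a, f (k a) = g a := by
  refine ⟨(LinearEquiv.ofInjective f hf).symm.toLinearMap ∘ₗ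
    g.codRestrict (LinearMap.range f) h, fun a => ?_⟩
  have := (LinearEquiv.ofInjective f hf).apply_symm_apply (g.codRestrict (LinearMap.range f) h a)
  exact congrArg Subtype.val this

/-- If every map `ker π → M` extends along `ker π ⊆ G`, and `π` factors through `p : B → T`, then
every map `ker p → M` extends to `B`. -/
theorem exists_extend_of_factor {G T M : Type u} [AddCommGroup G] [Module R G] [AddCommGroup T]
    [Module R T] [AddCommGroup M] [Module R M] (π : G →ₗ[R] T) (hπ : Function.Surjective π)
    (h : ∀ φ : LinearMap.ker π →ₗ[R] M, ∃ ψ : G →ₗ[R] M, ∀ k, ψ k.1 = φ k)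
    (p : B →ₗ[R] T) (l : G →ₗ[R] B) (hl : ∀ x, p (l x) = π x) (φ : LinearMap.ker p →ₗ[R] M) :
    ∃ ψ : B →ₗ[R] M, ∀ k, ψ k.1 = φ k := by
  obtain ⟨ψ₀, hψ₀⟩ := h (φ ∘ₗ l.restrict (p := LinearMap.ker π) (q := LinearMap.ker p)
    (fun x hx => by simpa [hl] using hx))
  -- Since `π` is onto, `B` is the pushout of `G` and `ker p` over `ker π`; `φ` and `ψ₀` agree on
  -- `ker π` and so glue.
  obtain ⟨ψ, hψ⟩ := exists_factor_of_surjective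
    ((LinearMap.ker p).subtype.coprod l) (fun b => by
      obtain ⟨x, hx⟩ := hπ (p b)
      exact ⟨(⟨b - l x, by simp [hl, hx]⟩, x), by simp⟩)
    (φ.coprod ψ₀) (by
      rintro ⟨⟨k, hk⟩, x⟩ hkx
      have hkx' : k + l x = 0 := by simpa using hkx
      have hx : x ∈ LinearMap.ker π := by
        have := congrArg p hkx'
        simpa [hl, LinearMap.mem_ker.1 hk] using this
      have h1 := hψ₀ ⟨x, hx⟩
      simp only [LinearMap.comp_apply] at h1
      simp only [LinearMap.coprod_apply]
      rw [h1, ← map_add]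
      convert map_zero φ
      exact Subtype.ext hkx')
  exact ⟨ψ, fun k => by simpa using hψ (k, 0)⟩

end LinearMaps

/-! ### Gorenstein projective modules -/

/-- A short exact sequence `0 → A → P → B → 0` with `P` projective which stays exact under
`Hom(-, Q)` for every projective module `Q`. -/
def IsLinked (A B : ModuleCat.{u} R) : Prop :=
  ∃ (P : ModuleCat.{u} R) (i : A →ₗ[R] P) (q : P →ₗ[R] B), Module.Projective R P ∧
    Function.Injective i ∧ Function.Exact i q ∧ Function.Surjective q ∧
    ∀ Q : ModuleCat.{u} R, Module.Projective R Q → ∀ f : A →ₗ[R] Q, ∃ g : P →ₗ[R] Q,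
      ∀ a, g (i a) = f a

/-! ### Complete resolutions as splicings of short exact sequences -/

theorem exists_int_sequence {α : Type*} (r : α → α → Prop) (hr : ∀ a, ∃ b, r a b)
    (hl : ∀ a, ∃ b, r b a) (a : α) : ∃ f : ℤ → α, f 0 = a ∧ ∀ n, r (f n) (f (n + 1)) := by
  choose s hs using hr
  choose t ht using hl
  let f : ℤ → α := fun n => match n with
    | Int.ofNat n => s^[n] a
    | Int.negSucc n => t^[n + 1] a
  refine ⟨f, rfl, fun n => ?_⟩
  match n with
  | Int.ofNat n =>
    change r (s^[n] a) (s^[n + 1] a)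
    rw [Function.iterate_succ_apply']
    exact hs _
  | Int.negSucc 0 => exact ht a
  | Int.negSucc (n + 1) =>
    change r (t^[n + 1 + 1] a) (t^[n + 1] a)
    rw [Function.iterate_succ_apply' t (n + 1)]
    exact ht _

/-- A class of modules each of which can be linked, on both sides, to modules of the class consists
of Gorenstein projective modules. -/
theorem isGorensteinProjective_of_forall_isLinked (S : Set (ModuleCat.{u} R))
    (hr : ∀ A ∈ S, ∃ B ∈ S, IsLinked A B) (hl : ∀ A ∈ S, ∃ B ∈ S, IsLinked B A)
    {A : ModuleCat.{u} R} (hA : A ∈ S) : IsGorensteinProjective A := by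
  obtain ⟨f, hf0, hf⟩ := exists_int_sequence (α := S) (fun A B => IsLinked A.1 B.1)
    (fun A => by obtain ⟨B, hB, h⟩ := hr A.1 A.2; exact ⟨⟨B, hB⟩, h⟩)
    (fun A => by obtain ⟨B, hB, h⟩ := hl A.1 A.2; exact ⟨⟨B, hB⟩, h⟩) ⟨A, hA⟩
  choose P i q hP hi hiq hq hext using hf
  have hexact : ∀ n, Function.Exact (i (n + 1) ∘ₗ q n) (i (n + 1 + 1) ∘ₗ q (n + 1)) := by
    intro n y
    rw [LinearMap.comp_apply, map_eq_zero_iff _ (hi _), hiq]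
    constructor
    · rintro ⟨a, rfl⟩
      obtain ⟨x, rfl⟩ := hq n a
      exact ⟨x, rfl⟩
    · rintro ⟨x, rfl⟩
      exact ⟨q n x, rfl⟩
  -- The spliced complex is P n → A (n+1) → P (n+1), so its kernel at 0 is the image of `i 0`, a
  -- copy of the given module.
  refine ⟨P, fun n => i (n + 1) ∘ₗ q n, hP, hexact, fun Q hQ n g => ?_, ?_⟩
  · constructor
    · intro hg
      have hg' : ∀ x, g (i (n + 1) x) = 0 := by
        intro x
        obtain ⟨y, rfl⟩ := hq n x
        exact LinearMap.congr_fun hg y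
      obtain ⟨k, hk⟩ := exists_factor_of_surjective (q (n + 1)) (hq _) g (by
        intro a ha
        obtain ⟨b, rfl⟩ := (hiq (n + 1) a).1 ha
        exact hg' b)
      obtain ⟨l, hl⟩ := hext (n + 1 + 1) Q hQ k
      refine ⟨l, LinearMap.ext fun x => ?_⟩
      simp [hl, hk]
    · rintro ⟨l, rfl⟩
      refine LinearMap.ext fun x => ?_
      have := (hiq (n + 1) _).2 ⟨q n x, rfl⟩
      simp [this]
  · have h0 : (f 0).1 = A := by rw [hf0]
    rw [← h0]
    refine ⟨LinearEquiv.ofBijective ((i 0).codRestrict _ fun x => ?_) ⟨?_, ?_⟩⟩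
    · have := (hiq 0 _).2 ⟨x, rfl⟩
      simp [this]
    · intro x y hxy
      exact hi 0 (congrArg Subtype.val hxy)
    · rintro ⟨y, hy⟩
      rw [LinearMap.mem_ker, LinearMap.comp_apply, map_eq_zero_iff _ (hi _), hiq] at hy
      obtain ⟨x, rfl⟩ := hy
      exact ⟨x, rfl⟩

theorem IsLinked.of_equiv {A B A' B' : ModuleCat.{u} R} (h : IsLinked A B)
    (e : A' ≃ₗ[R] A) (e' : B ≃ₗ[R] B') : IsLinked A' B' := by
  obtain ⟨P, i, q, hP, hi, hiq, hq, hext⟩ := h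
  refine ⟨P, i ∘ₗ e.toLinearMap, e'.toLinearMap ∘ₗ q, hP, hi.comp e.injective, fun y => ?_,
    e'.surjective.comp hq, fun Q hQ f => ?_⟩
  · simp only [LinearMap.comp_apply, LinearEquiv.coe_coe, LinearEquiv.map_eq_zero_iff, hiq y]
    constructor
    · rintro ⟨x, rfl⟩; exact ⟨e.symm x, by simp⟩
    · rintro ⟨x, rfl⟩; exact ⟨e x, rfl⟩
  · obtain ⟨g, hg⟩ := hext Q hQ (f ∘ₗ e.symm.toLinearMap)
    exact ⟨g, fun a => by simp [hg]⟩

section Syzygies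

variable (P : ℤ → ModuleCat.{u} R) (d : ∀ n : ℤ, P n →ₗ[R] P (n + 1))

/-- A map from ker dⁿ to a projective Q, pulled back to Pⁿ⁻¹, is a cocycle of Hom(P, Q). It is
therefore a coboundary, which is an extension to Pⁿ. -/
theorem isLinked_ker (hP : ∀ n, Module.Projective R (P n))
    (hd : ∀ n, Function.Exact (d n) (d (n + 1)))
    (hQ : ∀ Q : ModuleCat.{u} R, Module.Projective R Q → ∀ n,
      Function.Exact (fun g : P (n + 1 + 1) →ₗ[R] Q => g ∘ₗ d (n + 1))
        (fun f : P (n + 1) →ₗ[R] Q => f ∘ₗ d n)) (n : ℤ) :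
    IsLinked (ModuleCat.of R (LinearMap.ker (d n)))
      (ModuleCat.of R (LinearMap.ker (d (n + 1)))) := by
  obtain ⟨m, rfl⟩ : ∃ m, n = m + 1 := ⟨n - 1, by ring⟩
  refine ⟨P (m + 1), (LinearMap.ker (d (m + 1))).subtype,
    (d (m + 1)).codRestrict _ (fun x => (hd (m + 1) _).2 ⟨x, rfl⟩), hP _,
    Subtype.val_injective, fun y => ?_, ?_, fun Q hproj f => ?_⟩
  · constructor
    · intro h
      exact ⟨⟨y, congrArg Subtype.val h⟩, rfl⟩
    · rintro ⟨x, rfl⟩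
      exact Subtype.ext x.2
  · rintro ⟨y, hy⟩
    obtain ⟨x, rfl⟩ := (hd (m + 1) y).1 hy
    exact ⟨x, rfl⟩
  · obtain ⟨k, rfl⟩ : ∃ k, m = k + 1 := ⟨m - 1, by ring⟩
    let δ : P (k + 1) →ₗ[R] LinearMap.ker (d (k + 1 + 1)) :=
      (d (k + 1)).codRestrict _ (fun x => (hd (k + 1) _).2 ⟨x, rfl⟩)
    obtain ⟨g, hg⟩ := (hQ Q hproj k (f ∘ₗ δ)).1 (by
      refine LinearMap.ext fun x => ?_
      have : δ (d k x) = 0 := Subtype.ext ((hd k _).2 ⟨x, rfl⟩)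
      simp [this])
    refine ⟨g, ?_⟩
    rintro ⟨a, ha⟩
    obtain ⟨x, rfl⟩ := (hd (k + 1) a).1 ha
    exact LinearMap.congr_fun hg x

end Syzygies

theorem isGorensteinProjective_ker (P : ℤ → ModuleCat.{u} R) (d : ∀ n : ℤ, P n →ₗ[R] P (n + 1))
    (hP : ∀ n, Module.Projective R (P n)) (hd : ∀ n, Function.Exact (d n) (d (n + 1)))
    (hQ : ∀ Q : ModuleCat.{u} R, Module.Projective R Q → ∀ n,
      Function.Exact (fun g : P (n + 1 + 1) →ₗ[R] Q => g ∘ₗ d (n + 1))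
        (fun f : P (n + 1) →ₗ[R] Q => f ∘ₗ d n)) (n : ℤ) :
    IsGorensteinProjective (ModuleCat.of R (LinearMap.ker (d n))) := by
  refine isGorensteinProjective_of_forall_isLinked
    (Set.range fun n => ModuleCat.of R (LinearMap.ker (d n))) ?_ ?_ ⟨n, rfl⟩
  · rintro _ ⟨m, rfl⟩
    exact ⟨_, ⟨m + 1, rfl⟩, isLinked_ker P d hP hd hQ m⟩
  · rintro _ ⟨m, rfl⟩
    obtain ⟨k, rfl⟩ : ∃ k, m = k + 1 := ⟨m - 1, by ring⟩
    exact ⟨_, ⟨k, rfl⟩, isLinked_ker P d hP hd hQ k⟩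

theorem IsGorensteinProjective.exists_isLinked_right {A : ModuleCat.{u} R}
    (hA : IsGorensteinProjective A) : ∃ B, IsGorensteinProjective B ∧ IsLinked A B := by
  obtain ⟨P, d, hP, hd, hQ, ⟨e⟩⟩ := hA
  exact ⟨_, isGorensteinProjective_ker P d hP hd hQ (0 + 1),
    (isLinked_ker P d hP hd hQ 0).of_equiv e (LinearEquiv.refl R _)⟩

theorem IsGorensteinProjective.exists_isLinked_left {A : ModuleCat.{u} R}
    (hA : IsGorensteinProjective A) : ∃ B, IsGorensteinProjective B ∧ IsLinked B A := by
  obtain ⟨P, d, hP, hd, hQ, ⟨e⟩⟩ := hA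
  exact ⟨_, isGorensteinProjective_ker P d hP hd hQ (-1),
    (isLinked_ker P d hP hd hQ (-1)).of_equiv (LinearEquiv.refl R _) e.symm⟩

theorem IsGorensteinProjective.of_projective (A : ModuleCat.{u} R) (hA : Module.Projective R A) :
    IsGorensteinProjective A := by
  refine isGorensteinProjective_of_forall_isLinked {A | Module.Projective R A} ?_ ?_ hA
  · intro A hA
    refine ⟨ModuleCat.of R PUnit, (inferInstance : Module.Projective R PUnit.{u + 1}), A, LinearMap.id, 0,
      hA, Function.injective_id, fun y => by simp, fun y => ⟨0, Subsingleton.elim _ _⟩,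
      fun Q _ f => ⟨f, fun a => rfl⟩⟩
  · intro A hA
    refine ⟨ModuleCat.of R PUnit, (inferInstance : Module.Projective R PUnit.{u + 1}), A, 0, LinearMap.id,
      hA, fun x y _ => Subsingleton.elim _ _, fun y => by simp [eq_comm],
      Function.surjective_id, fun Q _ f => ⟨0, fun a => by simp [Subsingleton.elim a 0]⟩⟩

/-! ### Closure properties of the Gorenstein projective modules -/

open Classical in
theorem projective_finsupp (P : Type u) [AddCommGroup P] [Module R P] [Module.Projective R P] :
    Module.Projective R (ℕ →₀ P) :=
  Module.Projective.of_equiv (finsuppLequivDFinsupp (ι := ℕ) (M := P) R).symm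

theorem IsLinked.finsupp {A B : ModuleCat.{u} R} (h : IsLinked A B) :
    IsLinked (ModuleCat.of R (ℕ →₀ A)) (ModuleCat.of R (ℕ →₀ B)) := by
  obtain ⟨P, i, q, hP, hi, hiq, hq, hext⟩ := h
  refine ⟨ModuleCat.of R (ℕ →₀ P), Finsupp.mapRange.linearMap i, Finsupp.mapRange.linearMap q,
    projective_finsupp P,
    Finsupp.mapRange_injective _ (map_zero i) hi, fun y => ?_,
    Finsupp.mapRange_surjective _ (map_zero q) hq, fun Q hQ f => ?_⟩
  · constructor
    · intro hy
      have : ∀ n, ∃ a, i a = y n := fun n => (hiq _).1 (DFunLike.congr_fun hy n)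
      obtain ⟨k, hk⟩ := exists_lift_of_injective i hi (LinearMap.range i).subtype (fun a => a.2)
      refine ⟨y.support.sum fun n => Finsupp.single n (k ⟨y n, this n⟩), ?_⟩
      conv_rhs => rw [← y.sum_single, Finsupp.sum]
      simp [map_sum, hk]
    · rintro ⟨x, rfl⟩
      ext n
      exact (hiq _).2 ⟨x n, rfl⟩
  · choose g hg using fun n : ℕ => hext Q hQ (f ∘ₗ Finsupp.lsingle n)
    refine ⟨Finsupp.lsum ℕ g, fun a => ?_⟩
    have : (Finsupp.lsum ℕ g).comp (Finsupp.mapRange.linearMap i) = f := by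
      ext n a
      simp [hg]
    exact LinearMap.congr_fun this a

theorem IsGorensteinProjective.finsupp {A : ModuleCat.{u} R} (hA : IsGorensteinProjective A) :
    IsGorensteinProjective (ModuleCat.of R (ℕ →₀ A)) := by
  refine isGorensteinProjective_of_forall_isLinked
    {B | ∃ A : ModuleCat.{u} R, IsGorensteinProjective A ∧ B = ModuleCat.of R (ℕ →₀ A)} ?_ ?_
    ⟨A, hA, rfl⟩
  · rintro _ ⟨A, hA, rfl⟩
    obtain ⟨B, hB, h⟩ := hA.exists_isLinked_right
    exact ⟨_, ⟨B, hB, rfl⟩, h.finsupp⟩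
  · rintro _ ⟨A, hA, rfl⟩
    obtain ⟨B, hB, h⟩ := hA.exists_isLinked_left
    exact ⟨_, ⟨B, hB, rfl⟩, h.finsupp⟩

/-- This is Ext¹(B, Q) = 0 for Q projective. It is built into the sequence 0 → B' → L → B → 0 with L
projective, and passes to `C` because `L` lifts to `C`. -/
theorem IsGorensteinProjective.exists_extend {A B C Q : ModuleCat.{u} R}
    (hB : IsGorensteinProjective B) (hQ : Module.Projective R Q) (i : A →ₗ[R] C) (p : C →ₗ[R] B)
    (hi : Function.Injective i) (hip : Function.Exact i p) (hp : Function.Surjective p)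
    (f : A →ₗ[R] Q) : ∃ g : C →ₗ[R] Q, ∀ a, g (i a) = f a := by
  obtain ⟨B', -, L, k, l, hL, hk, hkl, hl, hext⟩ := hB.exists_isLinked_left
  obtain ⟨v, hv⟩ := Module.projective_lifting_property p l hp
  obtain ⟨t, ht⟩ := exists_lift_of_injective i hi (LinearMap.ker p).subtype
    (fun a => (hip _).1 a.2)
  obtain ⟨g, hg⟩ := exists_extend_of_factor l hl (M := Q) (fun φ => by
    obtain ⟨ψ, hψ⟩ := hext Q hQ (φ ∘ₗ k.codRestrict (LinearMap.ker l)
      (fun x => (hkl _).2 ⟨x, rfl⟩))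
    refine ⟨ψ, ?_⟩
    rintro ⟨x, hx⟩
    obtain ⟨y, rfl⟩ := (hkl x).1 hx
    exact hψ y) p v (fun x => LinearMap.congr_fun hv x) (f ∘ₗ t)
  refine ⟨g, fun a => ?_⟩
  have h1 := hg ⟨i a, (hip _).2 ⟨a, rfl⟩⟩
  have h2 : t ⟨i a, (hip _).2 ⟨a, rfl⟩⟩ = a := hi (ht _)
  simpa [h2] using h1

/-- The class of Gorenstein projective modules is closed under extensions. -/
theorem IsGorensteinProjective.of_extension {A B C : ModuleCat.{u} R}
    (hA : IsGorensteinProjective A) (hB : IsGorensteinProjective B) (i : A →ₗ[R] C)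
    (p : C →ₗ[R] B) (hi : Function.Injective i) (hip : Function.Exact i p)
    (hp : Function.Surjective p) : IsGorensteinProjective C := by
  refine isGorensteinProjective_of_forall_isLinked
    {C | ∃ (A B : ModuleCat.{u} R) (i : A →ₗ[R] C) (p : C →ₗ[R] B), IsGorensteinProjective A ∧
      IsGorensteinProjective B ∧ Function.Injective i ∧ Function.Exact i p ∧
      Function.Surjective p} ?_ ?_ ⟨A, B, i, p, hA, hB, hi, hip, hp⟩
  · rintro C ⟨A, B, i, p, hA, hB, hi, hip, hp⟩
    obtain ⟨A', hA', P, a, a', hP, ha, haa, ha', hextA⟩ := hA.exists_isLinked_right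
    obtain ⟨B', hB', Q, b, b', hQ, hb, hbb, hb', hextB⟩ := hB.exists_isLinked_right
    -- Horseshoe lemma on the right: `a` extends to `C` because Ext¹(B, P) = 0. The cokernel of C →
    -- P × Q is again an extension, of B' by A'.
    obtain ⟨w, hw⟩ := hB.exists_extend hP i p hi hip hp a
    let m : C →ₗ[R] P × Q := w.prod (b ∘ₗ p)
    let N := LinearMap.range m
    obtain ⟨ι, hι⟩ := exists_factor_of_surjective a' ha' (N.mkQ ∘ₗ LinearMap.inl R P Q) (by
      intro x hx
      obtain ⟨z, rfl⟩ := (haa x).1 hx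
      exact (Submodule.Quotient.mk_eq_zero N).2
        ⟨i z, by simp [m, hw, (hip (i z)).2 ⟨z, rfl⟩]⟩)
    let ρ : ((P × Q) ⧸ N) →ₗ[R] B' := N.liftQ (b' ∘ₗ LinearMap.snd R P Q) (by
      rintro _ ⟨c, rfl⟩
      exact (hbb _).2 ⟨p c, rfl⟩)
    refine ⟨ModuleCat.of R ((P × Q) ⧸ N), ⟨A', B', ι, ρ, hA', hB', ?_, ?_, ?_⟩,
      ModuleCat.of R (P × Q), m, N.mkQ, (inferInstance : Module.Projective R (P × Q)),
      ?_, ?_, N.mkQ_surjective, ?_⟩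
    · refine (injective_iff_map_eq_zero ι).2 fun x' hx' => ?_
      obtain ⟨x, rfl⟩ := ha' x'
      rw [hι] at hx'
      obtain ⟨c, hc⟩ := (Submodule.Quotient.mk_eq_zero N).1 hx'
      obtain ⟨h1, h2⟩ := Prod.ext_iff.1 hc
      obtain ⟨z, rfl⟩ := (hip c).1 (hb (h2.trans (map_zero b).symm))
      exact (haa x).2 ⟨z, (hw z).symm.trans h1⟩
    · intro y
      constructor
      · obtain ⟨⟨x, y⟩, rfl⟩ := N.mkQ_surjective y
        intro hy
        obtain ⟨z, rfl⟩ := (hbb y).1 hy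
        obtain ⟨c, rfl⟩ := hp z
        refine ⟨a' (x - w c), ?_⟩
        rw [hι]
        refine (Submodule.Quotient.eq N).2 ⟨-c, ?_⟩
        simp [m]
      · rintro ⟨x', rfl⟩
        obtain ⟨x, rfl⟩ := ha' x'
        rw [hι]
        exact map_zero b'
    · intro y
      obtain ⟨z, rfl⟩ := hb' y
      exact ⟨N.mkQ (0, z), rfl⟩
    · refine (injective_iff_map_eq_zero m).2 fun c hc => ?_
      obtain ⟨h1, h2⟩ := Prod.ext_iff.1 hc
      obtain ⟨z, rfl⟩ := (hip c).1 (hb (h2.trans (map_zero b).symm))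
      rw [ha (((hw z).symm.trans h1).trans (map_zero a).symm), map_zero]
    · exact fun y => Submodule.Quotient.mk_eq_zero N
    · intro Q' hQ' f
      obtain ⟨g, hg⟩ := hextA Q' hQ' (f ∘ₗ i)
      obtain ⟨k, hk⟩ := exists_factor_of_surjective p hp (f - g ∘ₗ w) (by
        intro c hc
        obtain ⟨z, rfl⟩ := (hip c).1 hc
        simp [hw, hg])
      obtain ⟨l, hl⟩ := hextB Q' hQ' k
      refine ⟨g.coprod l, fun c => ?_⟩
      change g (w c) + l (b (p c)) = f c
      rw [hl, hk]
      simp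
  · rintro C ⟨A, B, i, p, hA, hB, hi, hip, hp⟩
    obtain ⟨A', hA', P, a, a', hP, ha, haa, ha', hextA⟩ := hA.exists_isLinked_left
    obtain ⟨B', hB', Q, b, b', hQ, hb, hbb, hb', hextB⟩ := hB.exists_isLinked_left
    -- Horseshoe lemma on the left, with kernel an extension of B' by A'.
    obtain ⟨v, hv⟩ := Module.projective_lifting_property p b' hp
    replace hv : ∀ y, p (v y) = b' y := LinearMap.congr_fun hv
    let m : P × Q →ₗ[R] C := (i ∘ₗ a').coprod v
    have hm : ∀ x y, m (x, y) = i (a' x) + v y := fun x y => rfl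
    have hpm : ∀ x y, p (m (x, y)) = b' y := by
      intro x y
      rw [hm, map_add, (hip _).2 ⟨_, rfl⟩, hv, zero_add]
    let ι : A' →ₗ[R] LinearMap.ker m := (LinearMap.inl R P Q ∘ₗ a).codRestrict _ (fun z => by
      change m (a z, 0) = 0
      simp [hm, (haa (a z)).2 ⟨z, rfl⟩])
    obtain ⟨ρ, hρ⟩ := exists_lift_of_injective b hb
      (LinearMap.snd R P Q ∘ₗ (LinearMap.ker m).subtype) (by
        rintro ⟨⟨x, y⟩, hxy⟩
        refine (hbb y).1 ?_
        rw [← hpm x y, LinearMap.mem_ker.1 hxy, map_zero])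
    have hρs : Function.Surjective ρ := by
      intro z
      obtain ⟨s, hs⟩ := (hip (v (b z))).1 (by rw [hv, (hbb _).2 ⟨z, rfl⟩])
      obtain ⟨x, rfl⟩ := ha' s
      refine ⟨⟨(-x, b z), ?_⟩, hb (hρ _)⟩
      rw [LinearMap.mem_ker, hm, map_neg, map_neg, hs, neg_add_cancel]
    have hex : Function.Exact ι ρ := by
      intro y
      constructor
      · obtain ⟨⟨x, y⟩, hxy⟩ := y
        intro h
        have hy : y = 0 := by
          have := hρ ⟨(x, y), hxy⟩
          rw [h, map_zero] at this
          exact this.symm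
        subst hy
        rw [LinearMap.mem_ker, hm, map_zero, add_zero, map_eq_zero_iff _ hi, haa] at hxy
        obtain ⟨z, rfl⟩ := hxy
        exact ⟨z, rfl⟩
      · rintro ⟨z, rfl⟩
        exact hb ((hρ _).trans (map_zero b).symm)
    refine ⟨ModuleCat.of R (LinearMap.ker m), ⟨A', B', ι, ρ, hA', hB', ?_, hex, hρs⟩,
      ModuleCat.of R (P × Q), (LinearMap.ker m).subtype, m,
      (inferInstance : Module.Projective R (P × Q)), Subtype.val_injective, ?_, ?_, ?_⟩
    · intro x y hxy
      exact ha (congrArg (fun t => t.1.1) hxy)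
    · intro y
      constructor
      · intro h
        exact ⟨⟨y, h⟩, rfl⟩
      · rintro ⟨x, rfl⟩
        exact x.2
    · intro c
      obtain ⟨y, hy⟩ := hb' (p c)
      obtain ⟨s, hs⟩ := (hip (c - v y)).1 (by rw [map_sub, hv, hy, sub_self])
      obtain ⟨x, rfl⟩ := ha' s
      exact ⟨(x, y), by rw [hm, hs, sub_add_cancel]⟩
    · intro Q' hQ' f
      obtain ⟨g, hg⟩ := hextA Q' hQ' (f ∘ₗ ι)
      obtain ⟨k, hk⟩ := exists_factor_of_surjective ρ hρs
        (f - g ∘ₗ LinearMap.fst R P Q ∘ₗ (LinearMap.ker m).subtype) (by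
          intro c hc
          obtain ⟨z, rfl⟩ := (hex c).1 hc
          have := hg z
          simp only [LinearMap.sub_apply, sub_eq_zero]
          exact this.symm)
      obtain ⟨l, hl⟩ := hextB Q' hQ' k
      refine ⟨g.coprod l, fun c => ?_⟩
      have h1 := hl (ρ c)
      rw [hk, hρ] at h1
      change g c.1.1 + l c.1.2 = f c
      change l c.1.2 = f c - g c.1.1 at h1
      rw [h1, add_sub_cancel]

theorem IsGorensteinProjective.prod {A B : ModuleCat.{u} R} (hA : IsGorensteinProjective A)
    (hB : IsGorensteinProjective B) : IsGorensteinProjective (ModuleCat.of R (A × B)) :=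
  hA.of_extension hB (LinearMap.inl R A B) (LinearMap.snd R A B) LinearMap.inl_injective
    (Function.Exact.inl_snd) LinearMap.snd_surjective

/-- The class of Gorenstein projective modules is closed under direct summands. -/
theorem IsGorensteinProjective.of_retract {M G : ModuleCat.{u} R} (hG : IsGorensteinProjective G)
    (i : M →ₗ[R] G) (r : G →ₗ[R] M) (h : ∀ x, r (i x) = x) : IsGorensteinProjective M := by
  refine isGorensteinProjective_of_forall_isLinked
    {M | ∃ (G : ModuleCat.{u} R) (i : M →ₗ[R] G) (r : G →ₗ[R] M), IsGorensteinProjective G ∧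
      ∀ x, r (i x) = x} ?_ ?_ ⟨G, i, r, hG, h⟩
  · rintro M ⟨G, i, r, hG, h⟩
    obtain ⟨G', hG', P, j, q, hP, hj, hjq, hq, hext⟩ := hG.exists_isLinked_right
    -- The idempotent `i ∘ r` extends to an endomorphism `e` of `P` that need not be idempotent. The
    -- defect 1 - e² is absorbed by an extra factor `P`: the cokernel is a retract of G' × P.
    obtain ⟨e, he⟩ := hext P hP (j ∘ₗ i ∘ₗ r)
    replace he : ∀ x, e (j x) = j (i (r x)) := he
    let N := LinearMap.range (j ∘ₗ i)
    have hij : ∀ x, q (j x) = 0 := fun x => (hjq _).2 ⟨x, rfl⟩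
    obtain ⟨t, ht⟩ := exists_factor_of_surjective q hq (N.mkQ ∘ₗ e) (by
      intro y hy
      obtain ⟨x, rfl⟩ := (hjq y).1 hy
      exact (Submodule.Quotient.mk_eq_zero N).2 ⟨r x, (he x).symm⟩)
    refine ⟨ModuleCat.of R (P ⧸ N), ⟨ModuleCat.of R (G' × P),
      N.liftQ ((q ∘ₗ e).prod (LinearMap.id - e ∘ₗ e)) ?_, t.coprod N.mkQ,
      hG'.prod (.of_projective P hP), ?_⟩, P, j ∘ₗ i, N.mkQ, hP, ?_, ?_, N.mkQ_surjective, ?_⟩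
    · rintro _ ⟨x, rfl⟩
      rw [LinearMap.mem_ker]
      ext1 <;> simp [he, h, hij]
    · intro y
      obtain ⟨y, rfl⟩ := N.mkQ_surjective y
      change t (q (e y)) + N.mkQ (y - e (e y)) = N.mkQ y
      rw [ht, LinearMap.comp_apply, ← map_add, add_sub_cancel]
    · exact hj.comp (Function.LeftInverse.injective h)
    · exact fun y => Submodule.Quotient.mk_eq_zero N
    · intro Q hQ f
      obtain ⟨g, hg⟩ := hext Q hQ (f ∘ₗ r)
      exact ⟨g, fun a => by simp [hg, h]⟩
  · rintro M ⟨G, i, r, hG, h⟩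
    obtain ⟨G', hG', P, k, q, hP, hk, hkq, hq, hext⟩ := hG.exists_isLinked_left
    -- Dual argument: `e` lifts `i ∘ r` through `q`, and 1 - e² again passes through the factor `P`.
    obtain ⟨e, he⟩ := Module.projective_lifting_property q (i ∘ₗ r ∘ₗ q) hq
    replace he : ∀ x, q (e x) = i (r (q x)) := LinearMap.congr_fun he
    let N := LinearMap.ker (r ∘ₗ q)
    have hN : ∀ {y}, y ∈ N ↔ r (q y) = 0 := Iff.rfl
    have hqk : ∀ x, q (k x) = 0 := fun x => (hkq _).2 ⟨x, rfl⟩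
    obtain ⟨t, ht⟩ := exists_lift_of_injective k hk (e ∘ₗ N.subtype) (by
      rintro ⟨y, hy⟩
      refine (hkq _).1 ?_
      rw [LinearMap.comp_apply, he, Submodule.subtype_apply, hN.1 hy, map_zero])
    let s : G' →ₗ[R] N := (e ∘ₗ k).codRestrict N (fun x => by simp [hN, he, hqk])
    let z : P →ₗ[R] N := (LinearMap.id - e ∘ₗ e).codRestrict N (fun y => by simp [hN, he, h])
    have hsz : ∀ y : N, s (t y) + z y = y := by
      intro y
      refine Subtype.ext ?_
      change e (k (t y)) + (y.1 - e (e y.1)) = y.1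
      rw [ht]
      simp
    refine ⟨ModuleCat.of R N, ⟨ModuleCat.of R (G' × P), t.prod N.subtype, s.coprod z,
      hG'.prod (.of_projective P hP), hsz⟩, P, N.subtype, r ∘ₗ q, hP,
      Subtype.val_injective, ?_, (Function.LeftInverse.surjective h).comp hq, ?_⟩
    · intro y
      constructor
      · intro hy
        exact ⟨⟨y, hy⟩, rfl⟩
      · rintro ⟨x, rfl⟩
        exact x.2
    · intro Q hQ f
      obtain ⟨g, hg⟩ := hext Q hQ (f ∘ₗ s)
      refine ⟨g ∘ₗ e + f ∘ₗ z, fun a => ?_⟩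
      have h1 := hg (t a)
      rw [ht] at h1
      change g (e a.1) = f (s (t a)) at h1
      change g (e a.1) + f (z a.1) = f a
      rw [h1, ← map_add, hsz]

/-! ### Maps factoring through projective modules -/

/-- The map `f` factors through a projective module. -/
def FactorsThroughProjective {A B : ModuleCat.{u} R} (f : A →ₗ[R] B) : Prop :=
  ∃ (F : ModuleCat.{u} R) (α : A →ₗ[R] F) (β : F →ₗ[R] B), Module.Projective R F ∧ β ∘ₗ α = f

namespace FactorsThroughProjective

variable {A B C : ModuleCat.{u} R}

theorem comp_left {f : A →ₗ[R] B} (hf : FactorsThroughProjective f) (g : B →ₗ[R] C) :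
    FactorsThroughProjective (g ∘ₗ f) := by
  obtain ⟨F, α, β, hF, rfl⟩ := hf
  exact ⟨F, α, g ∘ₗ β, hF, rfl⟩

theorem comp_right {f : B →ₗ[R] C} (hf : FactorsThroughProjective f) (g : A →ₗ[R] B) :
    FactorsThroughProjective (f ∘ₗ g) := by
  obtain ⟨F, α, β, hF, rfl⟩ := hf
  exact ⟨F, α ∘ₗ g, β, hF, rfl⟩

theorem add {f g : A →ₗ[R] B} (hf : FactorsThroughProjective f)
    (hg : FactorsThroughProjective g) : FactorsThroughProjective (f + g) := by
  obtain ⟨F, α, β, hF, rfl⟩ := hf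
  obtain ⟨F', α', β', hF', rfl⟩ := hg
  exact ⟨ModuleCat.of R (F × F'), α.prod α', β.coprod β',
    (inferInstance : Module.Projective R (F × F')), by ext; simp⟩

end FactorsThroughProjective

theorem exists_shift (M : Type u) [AddCommGroup M] [Module R M] :
    ∃ S T : (ℕ →₀ M) →ₗ[R] (ℕ →₀ M), (∀ v, S v 0 = 0) ∧ (∀ v n, S v (n + 1) = v n) ∧
      ∀ v n, T v n = v (n + 1) :=
  ⟨Finsupp.lmapDomain M R Nat.succ, Finsupp.lcomapDomain Nat.succ Nat.succ_injective,
    fun v => Finsupp.mapDomain_of_notMem_range _ _ (by simp),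
    fun v n => Finsupp.mapDomain_apply Nat.succ_injective v n, fun v n => rfl⟩

/-- An endomorphism of a Gorenstein projective module which is idempotent modulo maps factoring
through projective modules splits, modulo such maps, through a Gorenstein projective module. -/
theorem IsGorensteinProjective.exists_splitting {C : ModuleCat.{u} R}
    (hC : IsGorensteinProjective C) (e : C →ₗ[R] C)
    (he : FactorsThroughProjective (e ∘ₗ e - e)) :
    ∃ (X : ModuleCat.{u} R) (σ : C →ₗ[R] X) (π : X →ₗ[R] C), IsGorensteinProjective X ∧
      (∀ x, π (σ x) = e x + e x - e (e x)) ∧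
      FactorsThroughProjective (LinearMap.id - σ ∘ₗ e ∘ₗ e ∘ₗ π) := by
  obtain ⟨F, w, j, hF, hjw⟩ := he
  replace hjw : ∀ x, e (e x) = e x + j (w x) := fun x => by
    have := LinearMap.congr_fun hjw x
    simp only [LinearMap.comp_apply, LinearMap.sub_apply] at this
    rw [this]; abel
  obtain ⟨S, T, hS0, hS1, hT⟩ := exists_shift (R := R) C
  obtain ⟨S', T', hS0', hS1', hT'⟩ := exists_shift (R := R) F
  let E : (ℕ →₀ C) →ₗ[R] (ℕ →₀ C) := Finsupp.mapRange.linearMap e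
  let W : (ℕ →₀ C) →ₗ[R] (ℕ →₀ F) := Finsupp.mapRange.linearMap w
  let J : (ℕ →₀ F) →ₗ[R] (ℕ →₀ C) := Finsupp.mapRange.linearMap j
  -- Eilenberg swindle. Modulo projectives E² = E, and TS = 1 while ST drops coordinate 0. Hence rs
  -- = 1, and 1 - sr is e placed in coordinate 0: the fibre of `r` is the image of `e`.
  let s : (ℕ →₀ C) →ₗ[R] (ℕ →₀ C) := LinearMap.id - E + S ∘ₗ E
  let r : (ℕ →₀ C) →ₗ[R] (ℕ →₀ C) := LinearMap.id - E + T ∘ₗ E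
  let α : (ℕ →₀ C) →ₗ[R] (ℕ →₀ F) := W + W - S' ∘ₗ W - T' ∘ₗ W
  have hJ : ∀ v n, J v n = j (v n) := fun v n => rfl
  have hs0 : ∀ v, s v 0 = v 0 - e (v 0) := fun v => by
    change v 0 - e (v 0) + S (E v) 0 = _
    rw [hS0, add_zero]
  have hs1 : ∀ v n, s v (n + 1) = v (n + 1) - e (v (n + 1)) + e (v n) := fun v n => by
    change v (n + 1) - e (v (n + 1)) + S (E v) (n + 1) = _
    rw [hS1]; rfl
  have hr : ∀ v n, r v n = v n - e (v n) + e (v (n + 1)) := fun v n => by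
    change v n - e (v n) + T (E v) n = _
    rw [hT]; rfl
  have hα0 : ∀ v, α v 0 = w (v 0) + w (v 0) - w (v 1) := fun v => by
    change w (v 0) + w (v 0) - S' (W v) 0 - T' (W v) 0 = _
    rw [hS0', hT', sub_zero]; rfl
  have hα1 : ∀ v n, α v (n + 1) = w (v (n + 1)) + w (v (n + 1)) - w (v n) - w (v (n + 2)) :=
    fun v n => by
      change w (v (n + 1)) + w (v (n + 1)) - S' (W v) (n + 1) - T' (W v) (n + 1) = _
      rw [hS1', hT']; rfl
  have hrs : ∀ v, r (s v) = v + J (α v) := by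
    intro v
    ext n
    rw [Finsupp.add_apply, hr, hJ]
    cases n with
    | zero =>
      rw [hs0, hs1, hα0]
      simp only [map_add, map_sub, hjw, zero_add]
      abel
    | succ n =>
      rw [hs1, hs1, hα1]
      simp only [map_add, map_sub, hjw]
      abel
  have hsr : ∀ v, v - Finsupp.single 0 (e (e (v 0))) = s (r v) - J (α v) := by
    intro v
    ext n
    rw [Finsupp.sub_apply, Finsupp.sub_apply, hJ]
    cases n with
    | zero =>
      rw [hs0, hr, hα0, Finsupp.single_eq_same]
      simp only [map_add, map_sub, hjw]
      abel
    | succ n =>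
      rw [hs1, hr, hr, hα1, Finsupp.single_eq_of_ne (by simp)]
      simp only [map_add, map_sub, hjw]
      abel
  -- Adding the projective summand makes `r` an honest split epimorphism with section (s, α). So
  -- `ker t` is a direct summand, with projection `ρ`.
  let t : (ℕ →₀ C) × (ℕ →₀ F) →ₗ[R] (ℕ →₀ C) := r.coprod (-J)
  have ht : ∀ v l, t (v, l) = r v - J l := fun v l => by simp [t, sub_eq_add_neg]
  let ρ : (ℕ →₀ C) × (ℕ →₀ F) →ₗ[R] LinearMap.ker t :=
    (LinearMap.id - s.prod α ∘ₗ t).codRestrict _ (by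
      rintro y
      have h1 : ∀ z, t (s z, α z) = z := fun z => by rw [ht, hrs, add_sub_cancel_right]
      simp [h1])
  have hρ : ∀ y : LinearMap.ker t, ρ y = y := fun y => Subtype.ext (by
    change y.1 - (s.prod α) (t y.1) = y.1
    rw [LinearMap.mem_ker.1 y.2, map_zero, sub_zero])
  have hpF : Module.Projective R (ℕ →₀ F) := projective_finsupp F
  refine ⟨ModuleCat.of R (LinearMap.ker t),
    ρ ∘ₗ LinearMap.inl R _ _ ∘ₗ Finsupp.lsingle 0,
    Finsupp.lapply 0 ∘ₗ LinearMap.fst R _ _ ∘ₗ (LinearMap.ker t).subtype,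
    (hC.finsupp.prod (.of_projective (ModuleCat.of R (ℕ →₀ F)) hpF)).of_retract
      (LinearMap.ker t).subtype ρ hρ, fun x => ?_, ?_⟩
  · change (Finsupp.single 0 x - s (t (Finsupp.single 0 x, 0)) : ℕ →₀ C) 0 = _
    rw [ht, map_zero J, sub_zero, Finsupp.sub_apply, hs0, hr, Finsupp.single_eq_same,
      Finsupp.single_eq_of_ne (by simp)]
    simp only [map_add, map_sub, map_zero]
    abel
  · refine ⟨ModuleCat.of R ((ℕ →₀ F) × (ℕ →₀ F)),
      ((LinearMap.snd R _ _).prod (α ∘ₗ LinearMap.fst R _ _)) ∘ₗ (LinearMap.ker t).subtype,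
      ρ ∘ₗ ((s ∘ₗ J ∘ₗ LinearMap.fst R _ _ - J ∘ₗ LinearMap.snd R _ _).prod
        (LinearMap.fst R _ _)),
      (inferInstance : Module.Projective R ((ℕ →₀ F) × (ℕ →₀ F))), LinearMap.ext fun y => ?_⟩
    obtain ⟨⟨v, l⟩, hy⟩ := y
    have hrl : r v = J l := by
      rw [LinearMap.mem_ker, ht, sub_eq_zero] at hy
      exact hy
    change ρ (s (J l) - J (α v), l) = (⟨(v, l), hy⟩ : LinearMap.ker t) -
      ρ (Finsupp.single 0 (e (e (v 0))), 0)
    conv_rhs => enter [1]; rw [← hρ ⟨(v, l), hy⟩]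
    rw [← map_sub, ← hrl, ← hsr]
    simp

/-! ### Special approximations -/

/-- Surjectivity is automatic, because R itself is Gorenstein projective. -/
theorem isGEpi_of_forall_exists_lift {G M : ModuleCat.{u} R} (f : G →ₗ[R] M)
    (h : ∀ G' : ModuleCat.{u} R, IsGorensteinProjective G' → ∀ h : G' →ₗ[R] M,
      ∃ k : G' →ₗ[R] G, f ∘ₗ k = h) : IsGEpi f := by
  refine ⟨fun m => ?_, h⟩
  obtain ⟨k, hk⟩ := h (ModuleCat.of R R)
    (.of_projective _ (inferInstance : Module.Projective R R)) (LinearMap.toSpanSingleton R M m)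
  refine ⟨k 1, ?_⟩
  have := LinearMap.congr_fun hk (1 : R)
  simpa using this

theorem GpContravariantlyFinite.exists_isGEpi (hGp : GpContravariantlyFinite R)
    (M : ModuleCat.{u} R) :
    ∃ (G : ModuleCat.{u} R) (f : G →ₗ[R] M), IsGorensteinProjective G ∧ IsGEpi f := by
  obtain ⟨G, f, hG, h⟩ := hGp M
  exact ⟨G, f, hG, isGEpi_of_forall_exists_lift f h⟩

/-- Every module has an approximation by a Gorenstein projective module which is injective on
morphisms from Gorenstein projective modules modulo projective modules. -/
theorem GpContravariantlyFinite.exists_stable_isGEpi (hGp : GpContravariantlyFinite R)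
    (M : ModuleCat.{u} R) :
    ∃ (X : ModuleCat.{u} R) (x : X →ₗ[R] M), IsGorensteinProjective X ∧ IsGEpi x ∧
      ∀ A : ModuleCat.{u} R, IsGorensteinProjective A → ∀ a : A →ₗ[R] X, x ∘ₗ a = 0 →
        FactorsThroughProjective a := by
  obtain ⟨G₀, f, hG₀, hf⟩ := hGp.exists_isGEpi M
  obtain ⟨G₁, g, hG₁, hg⟩ := hGp.exists_isGEpi (ModuleCat.of R (LinearMap.ker f))
  obtain ⟨G', hG', Q, i, q, hQ, hi, hiq, hq, -⟩ := hG₁.exists_isLinked_right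
  let g' : G₁ →ₗ[R] G₀ := (LinearMap.ker f).subtype ∘ₗ g
  have hfg : ∀ z, f (g' z) = 0 := fun z => (g z).2
  -- The pushout of `g'` and `i` is the cone of `g'` in the stable category. It is an extension of
  -- G' by G₀, hence Gorenstein projective.
  let N := LinearMap.range (g'.prod i)
  let ι : G₀ →ₗ[R] (G₀ × Q) ⧸ N := N.mkQ ∘ₗ LinearMap.inl R G₀ Q
  let κ : Q →ₗ[R] (G₀ × Q) ⧸ N := N.mkQ ∘ₗ LinearMap.inr R G₀ Q
  have hικ : ∀ z, ι (g' z) = - κ (i z) := fun z => by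
    rw [eq_neg_iff_add_eq_zero]
    change N.mkQ (g' z, 0) + N.mkQ (0, i z) = 0
    rw [← map_add]
    exact (Submodule.Quotient.mk_eq_zero N).2 ⟨z, by simp⟩
  let p : (G₀ × Q) ⧸ N →ₗ[R] G' := N.liftQ (q ∘ₗ LinearMap.snd R G₀ Q) (by
    rintro _ ⟨z, rfl⟩
    exact (hiq _).2 ⟨z, rfl⟩)
  have hC : IsGorensteinProjective (ModuleCat.of R ((G₀ × Q) ⧸ N)) := by
    refine hG₀.of_extension hG' ι p ?_ ?_ ?_
    · refine (injective_iff_map_eq_zero ι).2 fun z hz => ?_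
      obtain ⟨y, hy⟩ := (Submodule.Quotient.mk_eq_zero N).1 hz
      obtain ⟨h1, h2⟩ := Prod.ext_iff.1 hy
      have hy0 : y = 0 := hi (h2.trans (map_zero i).symm)
      rw [hy0, map_zero] at h1
      exact h1.symm
    · intro y
      constructor
      · obtain ⟨⟨x, y⟩, rfl⟩ := N.mkQ_surjective y
        intro hy
        obtain ⟨z, rfl⟩ := (hiq y).1 hy
        refine ⟨x - g' z, (Submodule.Quotient.eq N).2 ⟨-z, ?_⟩⟩
        simp
      · rintro ⟨x, rfl⟩
        exact map_zero q
    · intro y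
      obtain ⟨z, rfl⟩ := hq y
      exact ⟨N.mkQ (0, z), rfl⟩
  let c : (G₀ × Q) ⧸ N →ₗ[R] M := N.liftQ (f ∘ₗ LinearMap.fst R G₀ Q) (by
    rintro _ ⟨z, rfl⟩
    exact hfg z)
  have hcι : ∀ z, c (ι z) = f z := fun z => rfl
  obtain ⟨c', hc'⟩ := hf.2 _ hC c
  replace hc' : ∀ z, f (c' z) = c z := LinearMap.congr_fun hc'
  let e : (G₀ × Q) ⧸ N →ₗ[R] (G₀ × Q) ⧸ N := ι ∘ₗ c'
  have hce : ∀ z, c (e z) = c z := fun z => hc' z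
  -- If `c ∘ a = 0`, then `c' ∘ a` lands in `ker f` and lifts to G₁, and on G₁ the map `ι` factors
  -- through `Q`. Taking a = e - 1 makes `e` stably idempotent.
  have he : ∀ A : ModuleCat.{u} R, IsGorensteinProjective A →
      ∀ a : A →ₗ[R] ModuleCat.of R ((G₀ × Q) ⧸ N), (∀ z, c (a z) = 0) →
        FactorsThroughProjective (B := ModuleCat.of R ((G₀ × Q) ⧸ N)) (e ∘ₗ a) := by
    intro A hA a ha
    obtain ⟨b, hb⟩ := hg.2 A hA ((c' ∘ₗ a).codRestrict _ (fun z => by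
      rw [LinearMap.mem_ker, LinearMap.comp_apply, hc', ha]))
    refine ⟨Q, i ∘ₗ b, -κ, hQ, LinearMap.ext fun z => ?_⟩
    have h1 : g' (b z) = c' (a z) := congrArg Subtype.val (LinearMap.congr_fun hb z)
    change - κ (i (b z)) = ι (c' (a z))
    rw [← hικ, h1]
  obtain ⟨X, σ, π, hX, hπσ, hσ⟩ := hC.exists_splitting e (by
    have := he _ hC (e - LinearMap.id) (fun z => by
      change c (e z - z) = 0
      rw [map_sub, hce, sub_self])
    convert this using 1
    refine LinearMap.ext fun z => ?_
    change e (e z) - e z = e (e z - z)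
    rw [map_sub])
  refine ⟨X, c ∘ₗ π, hX, isGEpi_of_forall_exists_lift _ fun A hA h => ?_, fun A hA a ha => ?_⟩
  · obtain ⟨h', hh'⟩ := hf.2 A hA h
    refine ⟨σ ∘ₗ ι ∘ₗ h', LinearMap.ext fun z => ?_⟩
    change c (π (σ (ι (h' z)))) = h z
    rw [hπσ, map_sub, map_add, hce, hce, hce, add_sub_cancel_right, hcι]
    exact LinearMap.congr_fun hh' z
  · have h1 := he A hA (π ∘ₗ a) (LinearMap.congr_fun ha)
    convert (hσ.comp_right a).add (h1.comp_left (σ ∘ₗ e)) using 1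
    ext1 z
    change a z = (a z - σ (e (e (π (a z))))) + σ (e (e (π (a z))))
    rw [sub_add_cancel]

/-- Every module has a Gorenstein projective approximation whose kernel is right orthogonal to all
Gorenstein projective modules. -/
theorem GpContravariantlyFinite.exists_special_isGEpi (hGp : GpContravariantlyFinite R)
    (M : ModuleCat.{u} R) :
    ∃ (X : ModuleCat.{u} R) (x : X →ₗ[R] M), IsGorensteinProjective X ∧ IsGEpi x ∧
      ∀ A B : ModuleCat.{u} R, IsGorensteinProjective A → ∀ p : B →ₗ[R] A,
        Function.Surjective p → ∀ φ : LinearMap.ker p →ₗ[R] LinearMap.ker x,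
          ∃ ψ : B →ₗ[R] LinearMap.ker x, ∀ k, ψ k.1 = φ k := by
  obtain ⟨X, x, hX, hx, hker⟩ := hGp.exists_stable_isGEpi M
  refine ⟨X, x, hX, hx, fun A B hA p hp => ?_⟩
  obtain ⟨A', hA', P, i, q, hP, hi, hiq, hq, hext⟩ := hA.exists_isLinked_left
  obtain ⟨l, hl⟩ := Module.projective_lifting_property p q hp
  refine exists_extend_of_factor q hq (fun φ => ?_) p l (LinearMap.congr_fun hl)
  let i' : A' →ₗ[R] LinearMap.ker q := i.codRestrict _ (fun z => (hiq _).2 ⟨z, rfl⟩)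
  -- The map ΩA → ker x ⊆ X is killed by `x`, so it factors through a projective and extends to `P`.
  -- Subtracting a lift of the induced map A → M brings this extension into `ker x`.
  obtain ⟨F, α, β, hF, hαβ⟩ := hker A' hA' ((LinearMap.ker x).subtype ∘ₗ φ ∘ₗ i')
    (LinearMap.ext fun z => (φ (i' z)).2)
  obtain ⟨b, hb⟩ := hext F hF α
  have hbi : ∀ z, β (b (i z)) = φ (i' z) := fun z => by
    rw [hb]
    exact LinearMap.congr_fun hαβ z
  obtain ⟨h, hh⟩ := exists_factor_of_surjective q hq (x ∘ₗ β ∘ₗ b) (by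
    intro y hy
    obtain ⟨z, rfl⟩ := (hiq y).1 hy
    change x (β (b (i z))) = 0
    rw [hbi]
    exact (φ (i' z)).2)
  obtain ⟨h', hh'⟩ := hx.2 A hA h
  replace hh' : ∀ z, x (h' z) = h z := LinearMap.congr_fun hh'
  refine ⟨(β ∘ₗ b - h' ∘ₗ q).codRestrict _ (fun y => ?_), ?_⟩
  · change x (β (b y) - h' (q y)) = 0
    rw [map_sub, hh', hh]
    exact sub_self _
  · rintro ⟨y, hy⟩
    obtain ⟨z, rfl⟩ := (hiq y).1 hy
    refine Subtype.ext ?_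
    change β (b (i z)) - h' (q (i z)) = φ (i' z)
    rw [hbi, LinearMap.mem_ker.1 hy, map_zero, sub_zero]

/-! ### `G`-exact sequences -/

theorem IsGEpi.comp {X Y Z : ModuleCat.{u} R} {f : X →ₗ[R] Y} {g : Y →ₗ[R] Z} (hg : IsGEpi g)
    (hf : IsGEpi f) : IsGEpi (g ∘ₗ f) :=
  ⟨hg.1.comp hf.1, fun G hG => (hg.2 G hG).comp (hf.2 G hG)⟩

theorem IsGRightExact.isGEpi {X Y Z : ModuleCat.{u} R} {f : X →ₗ[R] Y} {g : Y →ₗ[R] Z}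
    (h : IsGRightExact f g) : IsGEpi g :=
  ⟨h.1.2, fun G hG => (h.2 G hG).2⟩

theorem IsGEpi.exact_comp {X Y Z : ModuleCat.{u} R} {g : Y →ₗ[R] Z}
    {f : X →ₗ[R] ModuleCat.of R (LinearMap.ker g)} (hf : IsGEpi f) :
    Function.Exact ((LinearMap.ker g).subtype ∘ₗ f) g := by
  intro y
  constructor
  · intro hy
    obtain ⟨x, hx⟩ := hf.1 ⟨y, hy⟩
    exact ⟨x, congrArg Subtype.val hx⟩
  · rintro ⟨x, rfl⟩
    exact (f x).2

theorem IsGEpi.exact_homPost {X Y Z : ModuleCat.{u} R} {g : Y →ₗ[R] Z}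
    {f : X →ₗ[R] ModuleCat.of R (LinearMap.ker g)} (hf : IsGEpi f) (G : ModuleCat.{u} R)
    (hG : IsGorensteinProjective G) :
    Function.Exact (homPost G ((LinearMap.ker g).subtype ∘ₗ f)) (homPost G g) := by
  intro h
  constructor
  · intro hh
    obtain ⟨k, hk⟩ := hf.2 G hG (h.codRestrict _ (LinearMap.congr_fun hh))
    exact ⟨k, LinearMap.ext fun z => congrArg Subtype.val (LinearMap.congr_fun hk z)⟩
  · rintro ⟨k, rfl⟩
    exact LinearMap.ext fun z => (f (k z)).2

theorem IsGEpi.isGRightExact {X Y Z : ModuleCat.{u} R} {g : Y →ₗ[R] Z}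
    {f : X →ₗ[R] ModuleCat.of R (LinearMap.ker g)} (hg : IsGEpi g) (hf : IsGEpi f) :
    IsGRightExact ((LinearMap.ker g).subtype ∘ₗ f) g :=
  ⟨⟨hf.exact_comp, hg.1⟩, fun G hG => ⟨hf.exact_homPost G hG, hg.2 G hG⟩⟩

/-! ### The class `T^{G⊥}` -/

theorem GpContravariantlyFinite.nonempty_properGpResolution (hGp : GpContravariantlyFinite R)
    (M : ModuleCat.{u} R) : Nonempty (ProperGpResolution M) := by
  choose G f hG hf using hGp.exists_isGEpi
  let K : ModuleCat.{u} R → ModuleCat.{u} R := fun N => ModuleCat.of R (LinearMap.ker (f N))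
  let k : ∀ N, G (K N) →ₗ[R] G N := fun N => (LinearMap.ker (f N)).subtype ∘ₗ f (K N)
  have hk : ∀ N x, k N x = 0 ↔ f (K N) x = 0 := fun N x =>
    map_eq_zero_iff (LinearMap.ker (f N)).subtype Subtype.val_injective
  have hex : ∀ N, Function.Exact (k (K N)) (k N) := fun N x =>
    (hk N x).trans ((hf (K (K N))).exact_comp x)
  have hhom : ∀ N E, IsGorensteinProjective E →
      Function.Exact (homPost E (k (K N))) (homPost E (k N)) := fun N E hE h => by
    refine Iff.trans ?_ ((hf (K (K N))).exact_homPost E hE h)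
    constructor
    · exact fun hh => LinearMap.ext fun z => (hk N _).1 (LinearMap.congr_fun hh z)
    · exact fun hh => LinearMap.ext fun z => (hk N _).2 (LinearMap.congr_fun hh z)
  let Z : ℕ → ModuleCat.{u} R := fun n => Nat.rec M (fun _ N => K N) n
  exact ⟨{
    G := fun n => G (Z n)
    isGorensteinProjective := fun n => hG _
    d := fun n => k (Z n)
    ε := f M
    augmentation := (hf M).isGRightExact (hf (K M))
    exact := fun n => hex (Z n)
    hom_exact := fun E hE n => hhom (Z n) E hE }⟩

/-- Every map `ker p → M` extends to the source of `p`. -/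
def ExtendsFromKer {B T : ModuleCat.{u} R} (p : B →ₗ[R] T) (M : ModuleCat.{u} R) : Prop :=
  ∀ φ : LinearMap.ker p →ₗ[R] M, ∃ ψ : B →ₗ[R] M, ∀ k, ψ k.1 = φ k

/-- `π` lifts through `p`, so one approximation decides the condition for all. This makes `Gext`
vanishing independent of the resolution. -/
theorem ExtendsFromKer.of_isGEpi {G B T M : ModuleCat.{u} R} {π : G →ₗ[R] T}
    (h : ExtendsFromKer π M) (hG : IsGorensteinProjective G) (hπ : Function.Surjective π)
    {p : B →ₗ[R] T} (hp : IsGEpi p) : ExtendsFromKer p M := by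
  obtain ⟨l, hl⟩ := hp.2 G hG π
  exact exists_extend_of_factor π hπ h p l (LinearMap.congr_fun hl)

/-- 1-cocycles are maps out of ker ε = G₁ / im d₁, and coboundaries are those that extend to G₀. -/
theorem ProperGpResolution.subsingleton_gext_one_iff {T : ModuleCat.{u} R}
    (𝒢 : ProperGpResolution T) (M : ModuleCat.{u} R) :
    Subsingleton (𝒢.Gext M 1) ↔ ExtendsFromKer 𝒢.ε M := by
  have hεd : ∀ z, 𝒢.ε (𝒢.d 0 z) = 0 := fun z => (𝒢.augmentation.1.1 _).2 ⟨z, rfl⟩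
  have hdd : ∀ z, 𝒢.d 0 (𝒢.d 1 z) = 0 := fun z => (𝒢.exact 0 _).2 ⟨z, rfl⟩
  let δ : 𝒢.G 1 →ₗ[R] LinearMap.ker 𝒢.ε := (𝒢.d 0).codRestrict _ hεd
  have hδ : Function.Surjective δ := by
    rintro ⟨y, hy⟩
    obtain ⟨x, rfl⟩ := (𝒢.augmentation.1.1 y).1 hy
    exact ⟨x, rfl⟩
  constructor
  · intro hsub φ
    let f : (𝒢.coboundary M 1).ker := ⟨φ ∘ₗ δ, LinearMap.ext fun z => by
      change φ (δ (𝒢.d 1 z)) = 0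
      rw [show δ (𝒢.d 1 z) = 0 from Subtype.ext (hdd z), map_zero]⟩
    have h : (QuotientAddGroup.mk f : 𝒢.Gext M 1) = 0 := Subsingleton.elim _ _
    rw [QuotientAddGroup.eq_zero_iff] at h
    obtain ⟨g, hg⟩ := h
    refine ⟨g, fun k => ?_⟩
    obtain ⟨x, rfl⟩ := hδ k
    exact LinearMap.congr_fun hg x
  · intro h
    refine subsingleton_of_forall_eq 0 fun y => ?_
    obtain ⟨⟨f, hf⟩, rfl⟩ := QuotientAddGroup.mk_surjective y
    rw [QuotientAddGroup.eq_zero_iff]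
    obtain ⟨φ, hφ⟩ := exists_factor_of_surjective δ hδ f (by
      intro x hx
      obtain ⟨z, rfl⟩ := (𝒢.exact 0 x).1 (congrArg Subtype.val hx)
      exact LinearMap.congr_fun hf z)
    obtain ⟨ψ, hψ⟩ := h φ
    exact ⟨ψ, LinearMap.ext fun x => (hψ (δ x)).trans (hφ x)⟩

theorem mem_GPerp_of_extendsFromKer {G T M : ModuleCat.{u} R} {π : G →ₗ[R] T}
    (hG : IsGorensteinProjective G) (hπ : Function.Surjective π) (h : ExtendsFromKer π M) :
    M ∈ GPerp T := fun 𝒢 =>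
  (𝒢.subsingleton_gext_one_iff M).2 (h.of_isGEpi hG hπ 𝒢.augmentation.isGEpi)

theorem GpContravariantlyFinite.extendsFromKer (hGp : GpContravariantlyFinite R)
    {B T M : ModuleCat.{u} R} (hM : M ∈ GPerp T) {p : B →ₗ[R] T} (hp : IsGEpi p) :
    ExtendsFromKer p M := by
  obtain ⟨𝒢⟩ := hGp.nonempty_properGpResolution T
  exact ((𝒢.subsingleton_gext_one_iff M).1 (hM 𝒢)).of_isGEpi (𝒢.isGorensteinProjective 0)
    𝒢.augmentation.1.2 hp

/-! ### The classes `Gen_G(T)` and `Pres_G(T)` -/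

theorem PresG_subset_GenG (T : ModuleCat.{u} R) : PresG T ⊆ GenG T := by
  rintro M ⟨_, _, T₀, hT₀, _, g, h⟩
  exact ⟨T₀, hT₀, g, h.isGEpi⟩

theorem Add_subset_PresG (T : ModuleCat.{u} R) : Add T ⊆ PresG T := by
  intro U hU
  refine ⟨U, hU, U, hU, 0, LinearMap.id, ⟨fun y => ?_, Function.surjective_id⟩, fun G _ =>
    ⟨fun y => ?_, fun y => ⟨y, rfl⟩⟩⟩
  · simp [eq_comm]
  · simp [homPost, eq_comm]

theorem GenG_of_isGEpi {T M N : ModuleCat.{u} R} (hM : M ∈ GenG T) {g : M →ₗ[R] N}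
    (hg : IsGEpi g) : N ∈ GenG T := by
  obtain ⟨T₀, hT₀, f, hf⟩ := hM
  exact ⟨T₀, hT₀, g ∘ₗ f, hg.comp hf⟩

theorem mem_PresG_of_ker_mem_GenG {T U M : ModuleCat.{u} R} (hU : U ∈ Add T) {g : U →ₗ[R] M}
    (hg : IsGEpi g) (h : ModuleCat.of R (LinearMap.ker g) ∈ GenG T) : M ∈ PresG T := by
  obtain ⟨T₁, hT₁, f, hf⟩ := h
  exact ⟨T₁, hT₁, U, hU, _, g, hg.isGRightExact hf⟩

theorem exists_universal_of_mem_GenG {T M : ModuleCat.{u} R} (hM : M ∈ GenG T) :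
    ∃ U ∈ Add T, ∃ g : U →ₗ[R] M, IsGEpi g ∧
      ∀ h : T →ₗ[R] M, ∃ k : T →ₗ[R] U, ∀ t, g (k t) = h t := by
  obtain ⟨T₀, ⟨J, i, p, hpi⟩, f, hf⟩ := hM
  let g : ((T →ₗ[R] M) →₀ T) →ₗ[R] M := Finsupp.lsum ℕ fun h => h
  have hg : ∀ h t, g (Finsupp.single h t) = h t := fun h t => by simp [g]
  -- The given G-epimorphism factors through `g`: `v` sends the j-th copy of `T` to the copy indexed
  -- by the map it induces. Hence `g` is a G-epimorphism too.
  let v : (J →₀ T) →ₗ[R] ((T →ₗ[R] M) →₀ T) :=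
    Finsupp.lmapDomain T R fun j => f ∘ₗ p ∘ₗ Finsupp.lsingle j
  have hv : g ∘ₗ v = f ∘ₗ p := by
    ext j t
    simp [v, hg]
  have hgf : ∀ x, g (v (i x)) = f x := fun x =>
    (LinearMap.congr_fun hv (i x)).trans (congrArg f (LinearMap.congr_fun hpi x))
  refine ⟨ModuleCat.of R ((T →ₗ[R] M) →₀ T), ⟨_, LinearMap.id, LinearMap.id, rfl⟩, g,
    ⟨fun m => ?_, fun G hG h => ?_⟩, fun h => ⟨Finsupp.lsingle h, hg h⟩⟩
  · obtain ⟨x, rfl⟩ := hf.1 m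
    exact ⟨_, hgf x⟩
  · obtain ⟨k, rfl⟩ := hf.2 G hG h
    exact ⟨v ∘ₗ i ∘ₗ k, LinearMap.ext fun z => hgf (k z)⟩

/-! ### Gorenstein silting modules are Gorenstein star modules -/

theorem IsGorensteinSilting.isGorensteinStar {T : ModuleCat.{u} R} (hT : IsGorensteinSilting T) :
    IsGorensteinStar T := by
  obtain ⟨G₁, G₀, θ, ⟨hG₁, hG₀, π, hθπ⟩, hD⟩ := hT
  have hπθ : ∀ z, π (θ z) = 0 := fun z => (hθπ.1.1 _).2 ⟨z, rfl⟩
  refine ⟨fun X T₀ Y f g _ hX hfg => ?_, Set.Subset.antisymm (fun M hM => ?_)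
    (PresG_subset_GenG T)⟩
  · obtain ⟨⟨hf, hex, hg⟩, hG⟩ := hfg
    have hgf : ∀ z, g (f z) = 0 := fun z => (hex _).2 ⟨z, rfl⟩
    refine ⟨fun a b hab => LinearMap.ext fun z => hf (LinearMap.congr_fun hab z), fun a => ?_,
      fun h => ?_⟩
    · constructor
      · intro ha
        obtain ⟨k, hk⟩ := exists_lift_of_injective f hf a
          (fun z => (hex _).1 (LinearMap.congr_fun ha z))
        exact ⟨k, LinearMap.ext hk⟩
      · rintro ⟨k, rfl⟩
        exact LinearMap.ext fun z => hgf _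
    · obtain ⟨a, ha⟩ := (hG G₀ hG₀).2.2 (h ∘ₗ π)
      replace ha : ∀ z, g (a z) = h (π z) := LinearMap.congr_fun ha
      obtain ⟨b, hb⟩ := exists_lift_of_injective f hf (a ∘ₗ θ) (fun z => (hex _).1 (by
        rw [LinearMap.comp_apply, ha, hπθ, map_zero]))
      rw [hD] at hX
      obtain ⟨b', hb'⟩ := hX b
      -- The correction `f ∘ b'` does not change the image in `Y` and makes the lift vanish on im θ
      -- = ker π.
      obtain ⟨k, hk⟩ := exists_factor_of_surjective π hθπ.1.2 (a - f ∘ₗ b') (by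
        intro y hy
        obtain ⟨z, rfl⟩ := (hθπ.1.1 y).1 hy
        have h1 : b' (θ z) = b z := LinearMap.congr_fun hb' z
        change a (θ z) - f (b' (θ z)) = 0
        rw [h1, hb]
        exact sub_self _)
      refine ⟨k, LinearMap.ext fun t => ?_⟩
      obtain ⟨z, rfl⟩ := hθπ.1.2 t
      change g (k (π z)) = h (π z)
      rw [hk]
      change g (a z - f (b' z)) = h (π z)
      rw [map_sub, hgf, sub_zero, ha]
  · obtain ⟨U, hU, g, hg, huniv⟩ := exists_universal_of_mem_GenG hM
    refine mem_PresG_of_ker_mem_GenG hU hg ?_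
    have hUD := PresG_subset_GenG T (Add_subset_PresG T hU)
    rw [hD] at hUD ⊢
    intro h
    obtain ⟨a, ha⟩ := hUD ((LinearMap.ker g).subtype ∘ₗ h)
    replace ha : ∀ z, a (θ z) = h z := LinearMap.congr_fun ha
    obtain ⟨b, hb⟩ := exists_factor_of_surjective π hθπ.1.2 (g ∘ₗ a) (by
      intro y hy
      obtain ⟨z, rfl⟩ := (hθπ.1.1 y).1 hy
      change g (a (θ z)) = 0
      rw [ha]
      exact (h z).2)
    obtain ⟨k, hk⟩ := huniv b
    refine ⟨(a - k ∘ₗ π).codRestrict _ (fun z => ?_), LinearMap.ext fun z => Subtype.ext ?_⟩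
    · change g (a z - k (π z)) = 0
      rw [map_sub, hk, hb]
      exact sub_self _
    · change a (θ z) - k (π (θ z)) = h z
      rw [hπθ, map_zero, sub_zero, ha]

/-! ### Gorenstein tilting modules are Gorenstein silting modules -/

/-- The kernel of the universal map onto M in Gen_G(T) lies in T^{G⊥} = Pres_G(T) ⊆ Gen_G(T), so M
has an Add T presentation. -/
theorem IsGorensteinTilting.GPerp_eq_GenG (hGp : GpContravariantlyFinite R) {T : ModuleCat.{u} R}
    (hT : IsGorensteinTilting T) : GPerp T = GenG T := by
  refine Set.Subset.antisymm (hT.le.trans (PresG_subset_GenG T)) fun M hM => ?_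
  obtain ⟨U, hU, g, hg, huniv⟩ := exists_universal_of_mem_GenG hM
  have hUT : U ∈ GPerp T := hT.ge (Add_subset_PresG T hU)
  refine hT.ge (mem_PresG_of_ker_mem_GenG hU hg (PresG_subset_GenG T (hT.le ?_)))
  obtain ⟨G, π, hG, hπ⟩ := hGp.exists_isGEpi T
  refine mem_GPerp_of_extendsFromKer hG hπ.1 fun φ => ?_
  obtain ⟨a, ha⟩ := hGp.extendsFromKer hUT hπ ((LinearMap.ker g).subtype ∘ₗ φ)
  obtain ⟨b, hb⟩ := exists_factor_of_surjective π hπ.1 (g ∘ₗ a) (by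
    intro y hy
    have h1 := ha ⟨y, hy⟩
    change g (a y) = 0
    rw [h1]
    exact (φ ⟨y, hy⟩).2)
  obtain ⟨k, hk⟩ := huniv b
  refine ⟨(a - k ∘ₗ π).codRestrict _ (fun z => ?_), ?_⟩
  · change g (a z - k (π z)) = 0
    rw [map_sub, hk, hb]
    exact sub_self _
  · rintro ⟨y, hy⟩
    refine Subtype.ext ?_
    change a y - k (π y) = φ ⟨y, hy⟩
    rw [LinearMap.mem_ker.1 hy, map_zero, sub_zero]
    exact ha ⟨y, hy⟩

/-! ### Gorenstein projectivity of the kernel of an approximation -/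

theorem exists_injective_extends (M : ModuleCat.{u} R) :
    ∃ (E : ModuleCat.{u} R) (j : M →ₗ[R] E), Function.Injective j ∧
      ∀ (A B : ModuleCat.{u} R) (i : A →ₗ[R] B), Function.Injective i → ∀ f : A →ₗ[R] E,
        ∃ g : B →ₗ[R] E, ∀ a, g (i a) = f a := by
  let E := CategoryTheory.Injective.under M
  have : CategoryTheory.Injective (ModuleCat.of R E) :=
    inferInstanceAs (CategoryTheory.Injective (CategoryTheory.Injective.under M))
  have hE : Module.Injective R E := Module.injective_module_of_injective_object R E
  exact ⟨E, (CategoryTheory.Injective.ι M).hom,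
    (ModuleCat.mono_iff_injective _).1 inferInstance,
    fun A B i hi f => hE.out i hi f⟩

/-- If `T^{G⊥}` is closed under `G`-epimorphic images, then the kernel of every `G`-epimorphism from
a Gorenstein projective module to `T` is Gorenstein projective. -/
theorem GpContravariantlyFinite.isGorensteinProjective_ker (hGp : GpContravariantlyFinite R)
    {G T : ModuleCat.{u} R} (hT : ∀ (M N : ModuleCat.{u} R) (g : M →ₗ[R] N), M ∈ GPerp T →
      IsGEpi g → N ∈ GPerp T) (hG : IsGorensteinProjective G) {π : G →ₗ[R] T} (hπ : IsGEpi π) :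
    IsGorensteinProjective (ModuleCat.of R (LinearMap.ker π)) := by
  obtain ⟨X, x, hX, hx, hW⟩ := hGp.exists_special_isGEpi (ModuleCat.of R (LinearMap.ker π))
  obtain ⟨E, j, hj, hE⟩ := exists_injective_extends (ModuleCat.of R (LinearMap.ker x))
  have hET : E ∈ GPerp T := mem_GPerp_of_extendsFromKer hG hπ.1 fun φ =>
    hE (ModuleCat.of R (LinearMap.ker π)) G (LinearMap.ker π).subtype Subtype.val_injective φ
  let N := LinearMap.range j
  -- Lifting through E → E/W is obstructed only by Ext¹(A, W), which vanishes for Gorenstein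
  -- projective A.
  have hN : IsGEpi (Z := ModuleCat.of R (E ⧸ N)) N.mkQ := by
    refine isGEpi_of_forall_exists_lift _ fun A hA h => ?_
    obtain ⟨A', -, P, i, q, hP, hi, hiq, hq, -⟩ := hA.exists_isLinked_left
    obtain ⟨a, ha⟩ := Module.projective_lifting_property N.mkQ (h ∘ₗ q) N.mkQ_surjective
    replace ha : ∀ y, N.mkQ (a y) = h (q y) := LinearMap.congr_fun ha
    obtain ⟨φ, hφ⟩ := exists_lift_of_injective j hj (a ∘ₗ (LinearMap.ker q).subtype) (by
      rintro ⟨y, hy⟩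
      refine (Submodule.Quotient.mk_eq_zero N).1 ((ha y).trans ?_)
      rw [LinearMap.mem_ker.1 hy, map_zero])
    obtain ⟨ψ, hψ⟩ := hW A P hA q hq φ
    obtain ⟨k, hk⟩ := exists_factor_of_surjective q hq (a - j ∘ₗ ψ) (by
      intro y hy
      change a y - j (ψ y) = 0
      have h1 := hψ ⟨y, hy⟩
      rw [h1, hφ]
      exact sub_self _)
    refine ⟨k, LinearMap.ext fun z => ?_⟩
    obtain ⟨y, rfl⟩ := hq z
    change N.mkQ (k (q y)) = h (q y)
    rw [hk, ← ha]
    exact (Submodule.Quotient.eq N).2 ⟨-ψ y, by simp⟩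
  obtain ⟨μ, hμ⟩ := hE _ X (LinearMap.ker x).subtype Subtype.val_injective j
  obtain ⟨ζ, hζ⟩ := exists_factor_of_surjective x hx.1 (N.mkQ ∘ₗ μ) (by
    intro y hy
    have h1 := hμ ⟨y, hy⟩
    exact (Submodule.Quotient.mk_eq_zero N).2 ⟨⟨y, hy⟩, h1.symm⟩)
  obtain ⟨ζ', hζ'⟩ := hGp.extendsFromKer (hT _ _ _ hET hN) hπ ζ
  obtain ⟨ν, hν⟩ := hN.2 G hG ζ'
  replace hν : ∀ z, N.mkQ (ν z) = ζ' z := LinearMap.congr_fun hν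
  -- `ν` lifts the extension to `G` of the map ker π → E/W induced by `μ`, so the difference lands
  -- in W. On W it agrees with `μ`, hence it is a retraction X → W.
  obtain ⟨ρ, hρ⟩ := exists_lift_of_injective j hj (μ - ν ∘ₗ (LinearMap.ker π).subtype ∘ₗ x) (by
    intro y
    refine (Submodule.Quotient.mk_eq_zero N).1 ?_
    change N.mkQ (μ y - ν (x y).1) = 0
    rw [map_sub, hν, hζ', hζ]
    exact sub_self _)
  have hρ' : ∀ w : LinearMap.ker x, ρ w.1 = w := fun w => hj (by
    rw [hρ]
    have h1 := hμ w
    change μ w.1 - ν (x w.1).1 = j w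
    rw [LinearMap.mem_ker.1 w.2]
    change μ w.1 - ν 0 = j w
    rw [map_zero, sub_zero]
    exact h1)
  obtain ⟨s, hs⟩ := exists_factor_of_surjective x hx.1
    (LinearMap.id - (LinearMap.ker x).subtype ∘ₗ ρ) (by
      intro y hy
      change y - (ρ y).1 = 0
      have h1 := hρ' ⟨y, hy⟩
      rw [h1, sub_self])
  refine hX.of_retract s x fun z => ?_
  obtain ⟨y, rfl⟩ := hx.1 z
  rw [hs]
  change x (y - (ρ y).1) = x y
  rw [map_sub, LinearMap.mem_ker.1 (ρ y).2, sub_zero]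

theorem IsGorensteinTilting.isGorensteinSilting (hGp : GpContravariantlyFinite R)
    {T : ModuleCat.{u} R} (hT : IsGorensteinTilting T) : IsGorensteinSilting T := by
  have hgen := hT.GPerp_eq_GenG hGp
  obtain ⟨G, π, hG, hπ⟩ := hGp.exists_isGEpi T
  -- With θ the inclusion of ker π, membership in D_θ is extension of maps from ker π to G, which is
  -- membership in T^{G⊥}.
  refine ⟨ModuleCat.of R (LinearMap.ker π), G, (LinearMap.ker π).subtype,
    ⟨hGp.isGorensteinProjective_ker (fun M N g hM hg => ?_) hG hπ, hG, π,
      hπ.isGRightExact (f := LinearMap.id)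
        ⟨Function.surjective_id, fun _ _ h => ⟨h, rfl⟩⟩⟩, ?_⟩
  · rw [hgen] at hM ⊢
    exact GenG_of_isGEpi hM hg
  · rw [← hgen]
    ext M
    constructor
    · intro hM φ
      obtain ⟨ψ, hψ⟩ := hGp.extendsFromKer hM hπ φ
      exact ⟨ψ, LinearMap.ext hψ⟩
    · intro hM
      refine mem_GPerp_of_extendsFromKer hG hπ.1 fun φ => ?_
      obtain ⟨ψ, hψ⟩ := hM φ
      exact ⟨ψ, LinearMap.congr_fun hψ⟩

end

end GorensteinSilting

theorem mainTheorem8 (R : Type u) [Ring R] [IsNoetherianRing R]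
    (hGp : GorensteinSilting.GpContravariantlyFinite R) :
    (∀ T : ModuleCat.{u} R,
      GorensteinSilting.IsGorensteinTilting T → GorensteinSilting.IsGorensteinSilting T) ∧
    (∀ T : ModuleCat.{u} R,
      GorensteinSilting.IsGorensteinSilting T → GorensteinSilting.IsGorensteinStar T) := by
  exact ⟨fun _ hT => hT.isGorensteinSilting hGp, fun _ hT => hT.isGorensteinStar⟩
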